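/- **Setting.** Let $\mu$ be a probability measure on a measurable space $\Omega$. Write $\|\cdot\|_2=\|\cdot\|_{L_2(\Omega,\mu)}$, and let $L_\infty(\Omega)$ be the space of all bounded measurable functions $f:\Omega\to\mathbb C$ with the norm $\|f\|_\infty=\sup_{x\in\Omega}|f(x)|$. For a finite family (dictionary) $\mathcal D=\{\varphi_j\}_{j=1}^N$ in a complex normed space $X$ and $0\le v\le N$, let $\Sigma_v(\mathcal D)$ be the union of the spaces $\operatorname{span}\{\varphi_j: j\in J\}$ over all $J\subset\{1,\dots,N\}$ with $|J|=v$ (so $\Sigma_0(\mathcal D)=\{0\}$), and let $\sigma_v(f,\mathcal D)_X=\inf_{g\in\Sigma_v(\mathcal D)}\|f-g\|_X$; for $X=L_\infty(\Omega)$ this is written $\sigma_v(f,\mathcal D)_\infty$. A family $\mathcal D_N=\{\varphi_j\}_{j=1}^N$ of measurable functions $\varphi_j:\Omega\to\mathbb C$ is a *uniformly bounded Riesz basis* with constants $0<R_1\le R_2<\infty$ if $\sup_{x\in\Omega}|\varphi_j(x)|\le1$ for all $j$ and $$R_1\Big(\sum_{j=1}^N|a_j|^2\Big)^{1/2}\le\Big\|\sum_{j=1}^N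 a_j\varphi_j\Big\|_2\le R_2\Big(\sum_{j=1}^N|a_j|^2\Big)^{1/2}\qquad\text{for all }(a_1,\dots,a_N)\in\mathbb C^N.$$ A finite set $\Omega_m=\{\xi^1,\dots,\xi^m\}\subset\Omega$ provides *universal discretization* for the collection $\mathcal X_u(\mathcal D_N)$ of all spaces $\operatorname{span}\{\varphi_j:j\in J\}$, $|J|=u$, if $$\tfrac12\|f\|_2^2\le\frac1m\sum_{\nu=1}^m|f(\xi^\nu)|^2\le\tfrac32\|f\|_2^2\qquad\text{for all } f\in\Sigma_u(\mathcal D_N).$$ Let $\mu_m$ be the uniform probability measure on $\Omega_m$, and let $\mathcal D_N(\Omega_m)$ be the family of the restrictions of the $\varphi_j$ to $\Omega_m$. For $0<t\le1$, a dictionary $\mathcal D=\{\varphi_i\}_{i\in I}$ of nonzero elements of a Hilbert space $H$ and $f_0\in H$, the *Weak Orthogonal Matching Pursuit* $\mathrm{WOMP}(\mathcal D;t)_H$ produces $f_1,f_2,\dots$ as follows: for $k\ge1$, $j_k\in I$ is any index with $|\langle f_{k-1},\psi_{j_k}\rangle|\ge t\sup_{i\in I}|\langle f_{k-1},\psi_i\rangle|$,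 where $\psi_i=\varphi_i/\|\varphi_i\|$; $G_k(f_0)$ is the orthogonal projection of $f_0$ onto $\operatorname{span}\{\varphi_{j_1},\dots,\varphi_{j_k}\}$; and $f_k=f_0-G_k(f_0)$. **Theorem 1.2.** There is an absolute constant $C>1$ such that for all $0<t\le1$ and $0<R_1\le R_2<\infty$ there is an integer $c=c(t,R_1,R_2)\ge1$ with the following property. Let $\mathcal D_N$ be a uniformly bounded Riesz basis in $L_2(\Omega,\mu)$ with constants $R_1,R_2$, let $1\le u\le N$ be an integer, and let $\Omega_m$ be a finite subset of $\Omega$ that provides universal discretization for $\mathcal X_u(\mathcal D_N)$. Then for every integer $0\le v\le u/(1+c)$, every $f_0\in L_\infty(\Omega)$, and every admissible choice of the indices $j_k$, the algorithm $\mathrm{WOMP}(\mathcal D_N(\Omega_m);t)_{L_2(\Omega_m,\mu_m)}$ applied to $f_0|_{\Omega_m}$ gives $$\|f_{cv}\|_{L_2(\Omega_m,\mu_m)}\le C\,\sigma_v(f_0,\mathcal D_N(\Omega_m))_{L_2(\Omega_m,\mu_m)}$$ and $$\|f_{cv}\|_{L_2(\Omega,\mu)}\le C\,\sigma_v(f_0,\mathcal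 D_N)_\infty .$$ In the second inequality $f_{cv}$ denotes the function $f_0-g$ on $\Omega$, where $g$ is the unique element of $\operatorname{span}\{\varphi_{j_1},\dots,\varphi_{j_{cv}}\}$ whose restriction to $\Omega_m$ is $G_{cv}(f_0|_{\Omega_m})$. -/

import Mathlib

open MeasureTheory
open scoped ENNReal

namespace SparseRecovery

noncomputable section

/-! ### Sparse elements and best `v`-term approximation -/

/-- `Σ_v(D)`: the union of the spans of all subfamilies of `D` with exactly `v` indices. -/
def sparseSet {ι E : Type*} [AddCommGroup E] [Module ℂ E] (D : ι → E) (v : ℕ) : Set E :=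
  {g | ∃ J : Finset ι, J.card = v ∧ g ∈ Submodule.span ℂ (D '' (J : Set ι))}

/-- `σ_v(f, D)`: the infimum of `nrm (f - g)` over `g ∈ Σ_v(D)`, for a norm `nrm` on `E`. -/
def bestApprox {ι E : Type*} [AddCommGroup E] [Module ℂ E] (nrm : E → ℝ) (D : ι → E)
    (v : ℕ) (f : E) : ℝ :=
  ⨅ g : sparseSet D v, nrm (f - (g : E))

/-- The uniform norm `‖f‖_∞ = sup_{x ∈ Ω} |f x|` (a true supremum over all points). -/
def supNorm {Ω : Type*} (f : Ω → ℂ) : ℝ := ⨆ x, ‖f x‖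

/-! ### Dictionaries of functions on a probability space -/

/-- A uniformly bounded Riesz basis with constants `R₁, R₂`. -/
structure IsUniformlyBoundedRieszBasis {Ω : Type*} [MeasurableSpace Ω] (μ : Measure Ω) {N : ℕ}
    (φ : Fin N → Ω → ℂ) (R₁ R₂ : ℝ) : Prop where
  aestronglyMeasurable : ∀ j, AEStronglyMeasurable (φ j) μ
  norm_le_one : ∀ j x, ‖φ j x‖ ≤ 1
  lower : ∀ a : Fin N → ℂ,
    R₁ * √(∑ j, ‖a j‖ ^ 2) ≤ lpNorm (∑ j, a j • φ j) 2 μ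
  upper : ∀ a : Fin N → ℂ,
    lpNorm (∑ j, a j • φ j) 2 μ ≤ R₂ * √(∑ j, ‖a j‖ ^ 2)

/-- The points `ξ¹, …, ξᵐ` provide universal discretization (of the `L₂` norm, with the
constants `1/2` and `3/2`) for the collection of the spans of all `u`-element subfamilies. -/
def UniversalDiscretization {Ω : Type*} [MeasurableSpace Ω] (μ : Measure Ω) {N m : ℕ}
    (ξ : Fin m → Ω) (φ : Fin N → Ω → ℂ) (u : ℕ) : Prop :=
  ∀ f ∈ sparseSet φ u,
    1 / 2 * lpNorm f 2 μ ^ 2 ≤ 1 / (m : ℝ) * ∑ ν, ‖f (ξ ν)‖ ^ 2 ∧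
      1 / (m : ℝ) * ∑ ν, ‖f (ξ ν)‖ ^ 2 ≤ 3 / 2 * lpNorm f 2 μ ^ 2

/-! ### The discrete Hilbert space -/

/-- The measure giving mass `1 / m` to each of `m` indexed points. -/
def uniformMeasure (m : ℕ) : Measure (Fin m) := (m : ℝ≥0∞)⁻¹ • Measure.count

instance (m : ℕ) : IsFiniteMeasure (uniformMeasure m) := by
  rcases Nat.eq_zero_or_pos m with rfl | hm
  · exact ⟨by simp [uniformMeasure, Measure.eq_zero_of_isEmpty]⟩
  · refine ⟨?_⟩
    rw [uniformMeasure, Measure.smul_apply, smul_eq_mul]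
    exact ENNReal.mul_lt_top (by simp [hm]) (by simp)

/-- `L₂(Ω_m, μ_m)`, the functions on the indexed point set with the uniform measure. -/
abbrev DiscreteL2 (m : ℕ) : Type := Lp ℂ 2 (uniformMeasure m)

/-- The restriction of a function to the points `ξ¹, …, ξᵐ`, as an element of
`L₂(Ω_m, μ_m)`. -/
def restrictTo {Ω : Type*} {m : ℕ} (ξ : Fin m → Ω) (f : Ω → ℂ) : DiscreteL2 m :=
  MemLp.toLp (fun ν => f (ξ ν)) MemLp.of_discrete

/-! ### Weak Orthogonal Matching Pursuit -/

/-- The span of the first `k` selected elements `D (j 0), …, D (j (k - 1))`; so `j k` is the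
index chosen at the `(k + 1)`-st iteration. -/
def selectedSpan {ι E : Type*} [AddCommGroup E] [Module ℂ E] (D : ι → E) (j : ℕ → ι) (k : ℕ) :
    Submodule ℂ E :=
  Submodule.span ℂ ((fun i => D (j i)) '' Set.Iio k)

instance {ι E : Type*} [AddCommGroup E] [Module ℂ E] (D : ι → E) (j : ℕ → ι) (k : ℕ) :
    FiniteDimensional ℂ (selectedSpan D j k) :=
  FiniteDimensional.span_of_finite ℂ ((Set.finite_Iio k).image _)

/-- `G_k(f₀)`: the orthogonal projection of `f₀` onto the span of the first `k` selected
elements. -/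
def wompApprox {ι H : Type*} [NormedAddCommGroup H] [InnerProductSpace ℂ H] (D : ι → H)
    (j : ℕ → ι) (f₀ : H) (k : ℕ) : H :=
  (selectedSpan D j k).starProjection f₀

/-- The residual `f_k = f₀ - G_k(f₀)`. -/
def wompResidual {ι H : Type*} [NormedAddCommGroup H] [InnerProductSpace ℂ H] (D : ι → H)
    (j : ℕ → ι) (f₀ : H) (k : ℕ) : H :=
  f₀ - wompApprox D j f₀ k

/-- The normalized dictionary `ψ_i = φ_i / ‖φ_i‖`. -/
def normalized {ι H : Type*} [NormedAddCommGroup H] [InnerProductSpace ℂ H] (D : ι → H)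
    (i : ι) : H :=
  ((‖D i‖⁻¹ : ℝ) : ℂ) • D i

/-- `j` is an admissible sequence of choices of the algorithm `WOMP(D; t)` applied to `f₀`. -/
def IsWOMP {ι H : Type*} [NormedAddCommGroup H] [InnerProductSpace ℂ H] (D : ι → H) (t : ℝ)
    (f₀ : H) (j : ℕ → ι) : Prop :=
  ∀ k, t * (⨆ i, ‖inner ℂ (normalized D i) (wompResidual D j f₀ k)‖) ≤
    ‖inner ℂ (normalized D (j k)) (wompResidual D j f₀ k)‖

/-- `r` is, as a function on all of `Ω`, the residual after `k` iterations of WOMP for the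
restricted dictionary: `r = f₀ - g`, where `g` is a combination of the selected `φ_j` whose
restriction to the points is the `k`-th approximant computed in `L₂(Ω_m, μ_m)`. -/
def IsResidualFunction {Ω : Type*} {N m : ℕ} (ξ : Fin m → Ω) (φ : Fin N → Ω → ℂ)
    (j : ℕ → Fin N) (f₀ : Ω → ℂ) (k : ℕ) (r : Ω → ℂ) : Prop :=
  ∃ g ∈ selectedSpan φ j k,
    restrictTo ξ g = wompApprox (fun i => restrictTo ξ (φ i)) j (restrictTo ξ f₀) k ∧
      r = f₀ - g

end

end SparseRecovery

/-!
On functions spanned by at most `u` of the `φ j`, universal discretization and the Riesz property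
give `a ∑ |z i|² ≤ ‖∑ z i φ i‖² ≤ b ∑ |z i|²` in `L₂(Ω_m, μ_m)`, with `a = R₁² / 2` and
`b = 3 R₂² / 2`. The theorem is therefore a statement about matching pursuit for a dictionary with
the restricted isometry property in a Hilbert space: `c v` iterations reach an error at most three
times that of any `v`-sparse `g = ∑_{i ∈ T} x i φ i`
(`norm_wompResidual_le_of_mem_sparseSet`).

For `A ⊆ T` with at most `n` indices not yet selected, the excess of `‖f_k‖²` over
`‖f₀ - ∑_{i ∈ A} x i φ i‖²` shrinks by the factor `ρ` in about `n / (a t² ρ)` iterations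
(`wompResidual_energy_le`). Using this for `A = T` only would cost a number of iterations that
depends on `‖f₀‖ / ‖f₀ - g‖`. Instead, `A` runs through the selected part of `T` enlarged by the `2 ^ l - 1`
largest remaining coefficients, `l = 0, 1, …`, up to the first `L` at which the remaining tail of
`x` drops by a large constant factor (`exists_wompResidual_phase`). The phase costs
`O(2 ^ L)` iterations, and afterwards either the energy is at most `9 ‖f₀ - g‖²`, or the tail of
`x` left unselected is so small that `2 ^ L` indices of `T` must have been selected. As the cost
is proportional to the number of indices gained, induction on the number of unselected indices
ends the argument after `O(v)` iterations (`norm_sq_wompResidual_le_of_card`). The ratio `b / a`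
enters the number of iterations and not the constant.

For the `L₂(Ω, μ)` bound, let `h` be `v`-sparse and let `g` extend the computed approximant. Then
`h - g` is `u`-sparse, so its `L₂(Ω, μ)` norm is controlled by its discrete norm, which is at most
`(1 + 3) ‖f₀ - h‖_∞`.
-/

namespace SparseRecovery

/-! ### Matching pursuit: one iteration -/

/-- The set of indices selected in the first `k` iterations. -/
def chosen {ι : Type*} [DecidableEq ι] (j : ℕ → ι) (k : ℕ) : Finset ι :=
  (Finset.range k).image j

lemma mem_span_image_finset {ι E : Type*} [AddCommGroup E] [Module ℂ E] {D : ι → E}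
    {J : Finset ι} {x : E} :
    x ∈ Submodule.span ℂ (D '' (J : Set ι)) ↔ ∃ y : ι → ℂ, ∑ i ∈ J, y i • D i = x := by
  classical
  rw [Submodule.mem_span_image_finset_iff_exists_fun]
  constructor
  · rintro ⟨y, rfl⟩
    refine ⟨fun i => if h : i ∈ J then y ⟨i, h⟩ else 0, ?_⟩
    rw [← Finset.sum_coe_sort J]
    simp
  · rintro ⟨y, rfl⟩
    exact ⟨fun i => y i, Finset.sum_coe_sort J fun i => y i • D i⟩

section Chosen

variable {ι : Type*} [DecidableEq ι]

lemma chosen_mono (j : ℕ → ι) {k l : ℕ} (h : k ≤ l) : chosen j k ⊆ chosen j l :=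
  Finset.image_subset_image (Finset.range_subset_range.2 h)

lemma card_chosen_le (j : ℕ → ι) (k : ℕ) : (chosen j k).card ≤ k :=
  Finset.card_image_le.trans (Finset.card_range k).le

lemma selectedSpan_eq_span_chosen {E : Type*} [AddCommGroup E] [Module ℂ E] (D : ι → E)
    (j : ℕ → ι) (k : ℕ) :
    selectedSpan D j k = Submodule.span ℂ (D '' (chosen j k : Set ι)) := by
  rw [selectedSpan, chosen, Finset.coe_image, Set.image_image, Finset.coe_range]

end Chosen

/-- Two-sided `ℓ₂` bounds, with constants `a` and `b` for the squared norms, for all combinations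
of at most `u` elements of `D` (a restricted isometry property). -/
structure IsSparseRiesz {ι E : Type*} [NormedAddCommGroup E] [Module ℂ E] (D : ι → E) (a b : ℝ)
    (u : ℕ) : Prop where
  lower : ∀ J : Finset ι, J.card ≤ u → ∀ z : ι → ℂ,
    a * ∑ i ∈ J, ‖z i‖ ^ 2 ≤ ‖∑ i ∈ J, z i • D i‖ ^ 2
  upper : ∀ J : Finset ι, J.card ≤ u → ∀ z : ι → ℂ,
    ‖∑ i ∈ J, z i • D i‖ ^ 2 ≤ b * ∑ i ∈ J, ‖z i‖ ^ 2

section Iteration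

variable {ι H : Type*} [NormedAddCommGroup H] [InnerProductSpace ℂ H] {D : ι → H} {j : ℕ → ι}
  {f₀ : H}

lemma norm_wompResidual_le_of_mem {k : ℕ} {y : H} (hy : y ∈ selectedSpan D j k) :
    ‖wompResidual D j f₀ k‖ ≤ ‖f₀ - y‖ := by
  rw [wompResidual, wompApprox, Submodule.starProjection_minimal]
  exact ciInf_le ⟨0, by rintro _ ⟨x, rfl⟩; exact norm_nonneg _⟩
    (⟨y, hy⟩ : selectedSpan D j k)

lemma wompApprox_mem (k : ℕ) : wompApprox D j f₀ k ∈ selectedSpan D j k :=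
  Submodule.starProjection_apply_mem _ _

lemma selectedSpan_mono {k l : ℕ} (h : k ≤ l) : selectedSpan D j k ≤ selectedSpan D j l :=
  Submodule.span_mono (Set.image_mono (Set.Iio_subset_Iio h))

lemma inner_wompResidual_eq_zero {k : ℕ} {y : H} (hy : y ∈ selectedSpan D j k) :
    inner ℂ (wompResidual D j f₀ k) y = 0 :=
  Submodule.starProjection_inner_eq_zero _ _ hy

lemma norm_wompResidual_antitone {k l : ℕ} (h : k ≤ l) :
    ‖wompResidual D j f₀ l‖ ≤ ‖wompResidual D j f₀ k‖ :=
  norm_wompResidual_le_of_mem (selectedSpan_mono h (wompApprox_mem k))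

lemma norm_normalized_le_one (i : ι) : ‖normalized D i‖ ≤ 1 := by
  rw [normalized, norm_smul, Complex.norm_real, norm_inv, norm_norm]
  exact inv_mul_le_one

lemma norm_inner_le_norm_inner_normalized {i : ι} (hD : ‖D i‖ ≤ 1) (f : H) :
    ‖inner ℂ f (D i)‖ ≤ ‖inner ℂ (normalized D i) f‖ := by
  rw [norm_inner_symm f, normalized, inner_smul_left, norm_mul, RCLike.norm_conj,
    Complex.norm_real, norm_inv, norm_norm]
  rcases eq_or_ne (D i) 0 with h | h
  · simp [h]
  · exact le_mul_of_one_le_left (norm_nonneg _) ((one_le_inv₀ (norm_pos_iff.2 h)).2 hD)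

/-- Projecting onto a span that contains the unit direction `ψ_{j k}` removes at least
the energy of the residual in that direction. -/
lemma norm_sq_wompResidual_succ_le (k : ℕ) :
    ‖wompResidual D j f₀ (k + 1)‖ ^ 2 ≤ ‖wompResidual D j f₀ k‖ ^ 2 -
      ‖inner ℂ (normalized D (j k)) (wompResidual D j f₀ k)‖ ^ 2 := by
  set ψ := normalized D (j k) with hψ
  set r := wompResidual D j f₀ k with hr
  have hmem : wompApprox D j f₀ k + inner ℂ ψ r • ψ ∈ selectedSpan D j (k + 1) := by
    refine Submodule.add_mem _ (selectedSpan_mono (Nat.le_succ k) (wompApprox_mem k))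
      (Submodule.smul_mem _ _ (Submodule.smul_mem _ _ (Submodule.subset_span ?_)))
    exact ⟨k, Set.mem_Iio.2 (Nat.lt_succ_self k), rfl⟩
  have h1 := norm_wompResidual_le_of_mem (f₀ := f₀) hmem
  have h2 : f₀ - (wompApprox D j f₀ k + inner ℂ ψ r • ψ) = r - inner ℂ ψ r • ψ := by
    rw [hr, wompResidual]; abel
  rw [h2] at h1
  have h3 : ‖r - inner ℂ ψ r • ψ‖ ^ 2 =
      ‖r‖ ^ 2 - 2 * ‖inner ℂ ψ r‖ ^ 2 + ‖inner ℂ ψ r‖ ^ 2 * ‖ψ‖ ^ 2 := by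
    rw [@norm_sub_sq ℂ, inner_smul_right, norm_smul, mul_pow, ← inner_conj_symm r ψ,
      RCLike.mul_conj]
    norm_cast
  have h4 : ‖ψ‖ ^ 2 ≤ 1 := pow_le_one₀ (norm_nonneg _) (norm_normalized_le_one _)
  have h5 := pow_le_pow_left₀ (norm_nonneg _) h1 2
  nlinarith [sq_nonneg ‖inner ℂ ψ r‖]

variable [DecidableEq ι]

/-- The difference between a combination over `T` and the current approximant has, outside the
selected indices, the coefficients of the former. -/
lemma exists_coeff_sub_wompApprox (A : Finset ι) (x : ι → ℂ) (k : ℕ) :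
    ∃ z : ι → ℂ, (∀ i ∈ A \ chosen j k, z i = x i) ∧
      ∑ i ∈ A, x i • D i - wompApprox D j f₀ k = ∑ i ∈ A ∪ chosen j k, z i • D i := by
  have hm := wompApprox_mem (D := D) (j := j) (f₀ := f₀) k
  rw [selectedSpan_eq_span_chosen, mem_span_image_finset] at hm
  obtain ⟨y, hy⟩ := hm
  refine ⟨fun i => (if i ∈ A then x i else 0) - (if i ∈ chosen j k then y i else 0), ?_, ?_⟩
  · intro i hi
    simp only [Finset.mem_sdiff] at hi
    simp [hi.1, hi.2]
  · rw [← hy]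
    simp only [sub_smul, Finset.sum_sub_distrib, ite_smul, zero_smul, Finset.sum_ite_mem]
    rw [Finset.union_inter_cancel_left, Finset.union_inter_cancel_right]

lemma sum_sdiff_chosen_le {a b : ℝ} {u : ℕ} (hD : IsSparseRiesz D a b u) (ha : 0 ≤ a)
    {A : Finset ι} (x : ι → ℂ) {k : ℕ} (hcard : (A ∪ chosen j k).card ≤ u) :
    a * ∑ i ∈ A \ chosen j k, ‖x i‖ ^ 2 ≤ ‖∑ i ∈ A, x i • D i - wompApprox D j f₀ k‖ ^ 2 := by
  obtain ⟨z, hz, hw⟩ := exists_coeff_sub_wompApprox (D := D) (j := j) (f₀ := f₀) A x k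
  rw [hw]
  refine le_trans (mul_le_mul_of_nonneg_left ?_ ha) (hD.lower _ hcard z)
  rw [Finset.sum_congr rfl fun i hi => by rw [← hz i hi]]
  exact Finset.sum_le_sum_of_subset_of_nonneg
    (Finset.sdiff_subset.trans Finset.subset_union_left) fun _ _ _ => by positivity

/-- If the residual is larger than the error of a combination over `A`, then it correlates with
one of the at most `n` elements of `A` that are not selected yet. -/
lemma norm_sq_wompResidual_sub_le {a b : ℝ} {u : ℕ} (hD : IsSparseRiesz D a b u) (ha : 0 < a)
    {A : Finset ι} (x : ι → ℂ) {k : ℕ} (hcard : (A ∪ chosen j k).card ≤ u) {n : ℝ}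
    (hn : ((A \ chosen j k).card : ℝ) ≤ n) {M : ℝ}
    (hM : ∀ i, ‖inner ℂ (wompResidual D j f₀ k) (D i)‖ ≤ M) :
    a * (‖wompResidual D j f₀ k‖ ^ 2 - ‖f₀ - ∑ i ∈ A, x i • D i‖ ^ 2) ≤ n * M ^ 2 := by
  set r := wompResidual D j f₀ k with hr
  set w := ∑ i ∈ A, x i • D i - wompApprox D j f₀ k with hw
  set B := A \ chosen j k with hB
  have hlow : a * ∑ i ∈ B, ‖x i‖ ^ 2 ≤ ‖w‖ ^ 2 := sum_sdiff_chosen_le hD ha.le x hcard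
  obtain ⟨z, hz, hwz⟩ := exists_coeff_sub_wompApprox (D := D) (j := j) (f₀ := f₀) A x k
  have hin : inner ℂ r w = ∑ i ∈ B, x i * inner ℂ r (D i) := by
    rw [hw, hwz, inner_sum]
    have hs : B ⊆ A ∪ chosen j k := Finset.sdiff_subset.trans Finset.subset_union_left
    rw [← Finset.sum_subset hs]
    · exact Finset.sum_congr rfl fun i hi => by rw [inner_smul_right, hz i hi]
    · intro i hi hiB
      have hc : i ∈ chosen j k := by
        by_contra hc
        rcases Finset.mem_union.1 hi with h | h
        · exact hiB (Finset.mem_sdiff.2 ⟨h, hc⟩)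
        · exact hc h
      rw [inner_smul_right, inner_wompResidual_eq_zero, mul_zero]
      rw [selectedSpan_eq_span_chosen]
      exact Submodule.subset_span ⟨i, hc, rfl⟩
  have hM0 : ∀ i ∈ B, ‖x i * inner ℂ r (D i)‖ ≤ ‖x i‖ * M := fun i _ => by
    rw [norm_mul]; exact mul_le_mul_of_nonneg_left (hM i) (norm_nonneg _)
  have hre : RCLike.re (inner ℂ r w) ≤ (∑ i ∈ B, ‖x i‖) * M := by
    rw [Finset.sum_mul]
    refine (RCLike.re_le_norm _).trans ?_
    rw [hin]
    exact (norm_sum_le _ _).trans (Finset.sum_le_sum hM0)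
  have hcs : (∑ i ∈ B, ‖x i‖) ^ 2 ≤ n * ∑ i ∈ B, ‖x i‖ ^ 2 :=
    (sq_sum_le_card_mul_sum_sq (s := B)).trans
      (mul_le_mul_of_nonneg_right hn (Finset.sum_nonneg fun _ _ => by positivity))
  have hsub : f₀ - ∑ i ∈ A, x i • D i = r - w := by
    rw [hr, hw, wompResidual]; abel
  have hexp : ‖r - w‖ ^ 2 = ‖r‖ ^ 2 - 2 * RCLike.re (inner ℂ r w) + ‖w‖ ^ 2 :=
    @norm_sub_sq ℂ _ _ _ _ r w
  rw [hsub, hexp]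
  have hn0 : 0 ≤ n := (Nat.cast_nonneg _).trans hn
  set s := ∑ i ∈ B, ‖x i‖ with hs
  set q := ∑ i ∈ B, ‖x i‖ ^ 2 with hq
  have hs0 : 0 ≤ s := Finset.sum_nonneg fun _ _ => norm_nonneg _
  have hq0 : 0 ≤ q := Finset.sum_nonneg fun _ _ => by positivity
  -- the arithmetic-geometric mean inequality in the form `2 a s M ≤ a² q + n M²`
  have key : 2 * a * (s * M) ≤ a * (a * q) + n * M ^ 2 := by
    refine le_of_sq_le_sq ?_ (by positivity)
    have h1 : (2 * a * (s * M)) ^ 2 ≤ 4 * (a * (a * q)) * (n * M ^ 2) := by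
      have := mul_le_mul_of_nonneg_left hcs (by positivity : 0 ≤ 4 * a ^ 2 * M ^ 2)
      linarith [this]
    nlinarith [sq_nonneg (a * (a * q) - n * M ^ 2)]
  nlinarith [mul_le_mul_of_nonneg_left hlow ha.le, mul_le_mul_of_nonneg_left hre ha.le]

end Iteration

/-! ### Matching pursuit: many iterations -/

section Phases

variable {ι H : Type*} [NormedAddCommGroup H] [InnerProductSpace ℂ H] {D : ι → H} {j : ℕ → ι}
  {f₀ : H} [DecidableEq ι]

lemma wompResidual_energy_step [Finite ι] {t : ℝ} (ht : 0 < t) (hj : IsWOMP D t f₀ j)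
    (hD1 : ∀ i, ‖D i‖ ≤ 1) {a b : ℝ} {u : ℕ} (hD : IsSparseRiesz D a b u) (ha : 0 < a)
    {A : Finset ι} (x : ι → ℂ) {k : ℕ} (hcard : (A ∪ chosen j k).card ≤ u) {n : ℝ}
    (hn : ((A \ chosen j k).card : ℝ) ≤ n) :
    a * t ^ 2 * (‖wompResidual D j f₀ k‖ ^ 2 - ‖f₀ - ∑ i ∈ A, x i • D i‖ ^ 2) ≤
      n * (‖wompResidual D j f₀ k‖ ^ 2 - ‖wompResidual D j f₀ (k + 1)‖ ^ 2) := by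
  set M := ⨆ i, ‖inner ℂ (normalized D i) (wompResidual D j f₀ k)‖ with hM
  have hMi : ∀ i, ‖inner ℂ (wompResidual D j f₀ k) (D i)‖ ≤ M := fun i =>
    (norm_inner_le_norm_inner_normalized (hD1 i) _).trans
      (le_ciSup (f := fun i => ‖inner ℂ (normalized D i) (wompResidual D j f₀ k)‖)
        (Set.finite_range _).bddAbove i)
  have h1 := norm_sq_wompResidual_sub_le hD ha x hcard hn hMi
  have h2 := norm_sq_wompResidual_succ_le (D := D) (j := j) (f₀ := f₀) k
  have hM0 : 0 ≤ M := (norm_nonneg _).trans (hMi (j k))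
  have h3 : (t * M) ^ 2 ≤ _ := pow_le_pow_left₀ (by positivity) (hj k) 2
  have hn0 : 0 ≤ n := (Nat.cast_nonneg _).trans hn
  have h4 := mul_le_mul_of_nonneg_left (h3.trans (le_sub_comm.1 h2)) hn0
  have h5 := mul_le_mul_of_nonneg_left h1 (sq_nonneg t)
  linarith

/-- After `K` iterations the excess of the energy over `P` has shrunk by the factor `ρ`. The
energies decrease, so summing the one-step bounds gives `(1 + K θ) (E_K - P) ≤ E_0 - P` with
`θ = a t² / n`, which is all that is needed. -/
lemma wompResidual_energy_le [Finite ι] {t : ℝ} (ht : 0 < t) (hj : IsWOMP D t f₀ j)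
    (hD1 : ∀ i, ‖D i‖ ≤ 1) {a b : ℝ} {u : ℕ} (hD : IsSparseRiesz D a b u) (ha : 0 < a)
    {A : Finset ι} (x : ι → ℂ) {k K : ℕ} (hcard : (A ∪ chosen j (k + K)).card ≤ u) {n : ℝ}
    (hn : ((A \ chosen j k).card : ℝ) ≤ n) (hn0 : 0 < n) {P ρ : ℝ}
    (hP : ‖f₀ - ∑ i ∈ A, x i • D i‖ ^ 2 ≤ P) (hρ : 0 ≤ ρ) (hK : n ≤ K * (a * t ^ 2) * ρ) :
    ‖wompResidual D j f₀ (k + K)‖ ^ 2 ≤ P + ρ * ‖wompResidual D j f₀ k‖ ^ 2 := by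
  have hat : 0 < a * t ^ 2 := by positivity
  have main : ∀ i ≤ K, a * t ^ 2 * i * (‖wompResidual D j f₀ (k + i)‖ ^ 2 - P) ≤
      n * (‖wompResidual D j f₀ k‖ ^ 2 - ‖wompResidual D j f₀ (k + i)‖ ^ 2) := by
    intro i
    induction i with
    | zero => simp
    | succ i ih =>
      intro hi
      have h1 := ih (by omega)
      have h2 := wompResidual_energy_step ht hj hD1 hD ha x (k := k + i)
        ((Finset.card_le_card (Finset.union_subset_union_right
          (chosen_mono j (by omega : k + i ≤ k + K)))).trans hcard)
        ((Nat.cast_le.2 (Finset.card_le_card (Finset.sdiff_subset_sdiff subset_rfl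
          (chosen_mono j (Nat.le_add_right k i))))).trans hn)
      have h3 : ‖wompResidual D j f₀ (k + i + 1)‖ ^ 2 ≤ ‖wompResidual D j f₀ (k + i)‖ ^ 2 :=
        pow_le_pow_left₀ (norm_nonneg _) (norm_wompResidual_antitone (Nat.le_succ _)) 2
      have h4 := mul_le_mul_of_nonneg_left h3
        (by positivity : 0 ≤ a * t ^ 2 * ((i : ℝ) + 1))
      have h5 := mul_le_mul_of_nonneg_left hP hat.le
      rw [← add_assoc k i 1]
      push_cast
      linarith
  have h := main K le_rfl
  set E := ‖wompResidual D j f₀ (k + K)‖ ^ 2 with hE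
  set E₀ := ‖wompResidual D j f₀ k‖ ^ 2 with hE0
  have hE0' : 0 ≤ E₀ := by positivity
  have hE' : 0 ≤ E := by positivity
  rcases le_total E P with hle | hle
  · nlinarith [mul_nonneg hρ hE0']
  · have hKpos : 0 < (K : ℝ) * (a * t ^ 2) := by
      by_contra hneg
      nlinarith
    have h6 : K * (a * t ^ 2) * (E - P) ≤ K * (a * t ^ 2) * (ρ * E₀) := by
      nlinarith [mul_le_mul_of_nonneg_right hK hE0', mul_nonneg hn0.le hE']
    linarith [le_of_mul_le_mul_left h6 hKpos]

lemma norm_sq_sub_sum_le {a b : ℝ} {u : ℕ} (hD : IsSparseRiesz D a b u) {A T : Finset ι}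
    (hA : A ⊆ T) (hT : T.card ≤ u) (x : ι → ℂ) :
    ‖f₀ - ∑ i ∈ A, x i • D i‖ ^ 2 ≤
      2 * ‖f₀ - ∑ i ∈ T, x i • D i‖ ^ 2 + 2 * b * ∑ i ∈ T \ A, ‖x i‖ ^ 2 := by
  have h1 := hD.upper (T \ A) ((Finset.card_le_card Finset.sdiff_subset).trans hT) x
  have h2 : f₀ - ∑ i ∈ A, x i • D i =
      (f₀ - ∑ i ∈ T, x i • D i) + ∑ i ∈ T \ A, x i • D i := by
    rw [← Finset.sum_sdiff hA]; abel
  have h3 := norm_add_le (f₀ - ∑ i ∈ T, x i • D i) (∑ i ∈ T \ A, x i • D i)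
  rw [← h2] at h3
  have h4 := pow_le_pow_left₀ (norm_nonneg _) h3 2
  nlinarith [sq_nonneg (‖f₀ - ∑ i ∈ T, x i • D i‖ - ‖∑ i ∈ T \ A, x i • D i‖)]

lemma exists_min_sum_sdiff (S : Finset ι) (w : ι → ℝ) (n : ℕ) :
    ∃ A ⊆ S, A.card ≤ n ∧ ∀ B ⊆ S, B.card ≤ n → ∑ i ∈ S \ A, w i ≤ ∑ i ∈ S \ B, w i := by
  obtain ⟨A, hA, hmin⟩ := Finset.exists_min_image (S.powerset.filter (·.card ≤ n))
    (fun A => ∑ i ∈ S \ A, w i) ⟨∅, by simp⟩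
  simp only [Finset.mem_filter, Finset.mem_powerset] at hA hmin
  exact ⟨A, hA.1, hA.2, fun B h1 h2 => hmin B ⟨h1, h2⟩⟩

/-- One phase of the algorithm. Let `S` be the part of `T` that is not selected yet and `q l` the
smallest tail `∑_{S \ A} ‖x i‖²` with `|A| ≤ 2 ^ l - 1`. Let `L` be the first `l` at which the
tail drops by the factor `μ = 16 b / a`. Iterating `κ 2 ^ (l + 1)` times for each `l ≤ L`
brings the energy below a multiple of the error plus a small multiple of `q L`. Either the error
dominates, or what remains of `T` has a tail smaller than `q L`, so that at least `2 ^ L`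
indices of `T` were selected in the phase. -/
lemma exists_wompResidual_phase [Finite ι] {t : ℝ} (ht : 0 < t) (hj : IsWOMP D t f₀ j)
    (hD1 : ∀ i, ‖D i‖ ≤ 1) {a b : ℝ} {u : ℕ} (hD : IsSparseRiesz D a b u) (ha : 0 < a)
    (hab : a ≤ b) {κ : ℕ} (hκ : 32 * b ≤ κ * (a ^ 2 * t ^ 2)) (T : Finset ι) (x : ι → ℂ) (k : ℕ)
    (hS : (T \ chosen j k).Nonempty) :
    ∃ L : ℕ, 2 ^ L ≤ (T \ chosen j k).card ∧
      ∀ k', k' + 2 * κ = k + 4 * κ * 2 ^ L → T.card + k' ≤ u →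
        ‖wompResidual D j f₀ k'‖ ^ 2 ≤ 9 * ‖f₀ - ∑ i ∈ T, x i • D i‖ ^ 2 ∨
        (T \ chosen j k').card + 2 ^ L ≤ (T \ chosen j k).card := by
  set S := T \ chosen j k with hSdef
  have hST : S ⊆ T := Finset.sdiff_subset
  set e := ‖f₀ - ∑ i ∈ T, x i • D i‖ ^ 2 with he
  have he0 : 0 ≤ e := by positivity
  have hb : 0 < b := ha.trans_le hab
  choose A hAS hAcard hAmin using fun l : ℕ =>
    exists_min_sum_sdiff S (fun i => ‖x i‖ ^ 2) (2 ^ l - 1)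
  set q : ℕ → ℝ := fun l => ∑ i ∈ S \ A l, ‖x i‖ ^ 2 with hq
  have hq0 : ∀ l, 0 ≤ q l := fun l => Finset.sum_nonneg fun _ _ => by positivity
  have hqz : ∀ l, S.card ≤ 2 ^ l - 1 → q l = 0 := fun l hl =>
    le_antisymm ((hAmin l S subset_rfl hl).trans (by simp)) (hq0 l)
  -- The condition `μ q (l + 1) ≤ q l`, without the division.
  have hex : ∃ l, 16 * b * q (l + 1) ≤ a * q l := by
    refine ⟨S.card, ?_⟩
    rw [hqz (S.card + 1)]
    · simpa using mul_nonneg ha.le (hq0 _)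
    · have : S.card + 1 < 2 ^ (S.card + 1) := Nat.lt_two_pow_self
      omega
  classical
  set L := Nat.find hex with hL
  have hLspec : 16 * b * q (L + 1) ≤ a * q L := Nat.find_spec hex
  have hLmin : ∀ l < L, a * q l < 16 * b * q (l + 1) := fun l hl =>
    not_le.1 (Nat.find_min hex hl)
  have hLcard : 2 ^ L ≤ S.card := by
    by_contra hlt
    have hL0 : L ≠ 0 := by
      intro h0
      rw [h0, pow_zero] at hlt
      exact hlt (Finset.card_pos.2 hS)
    have h1 := hLmin (L - 1) (by omega)
    rw [Nat.sub_add_cancel (Nat.pos_of_ne_zero hL0), hqz L (by omega)] at h1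
    nlinarith [hq0 (L - 1)]
  refine ⟨L, hLcard, fun k' hk' hu => ?_⟩
  -- `T` is restricted to the indices selected so far and the `2 ^ l - 1` best remaining ones.
  set A' : ℕ → Finset ι := fun l => (T ∩ chosen j k) ∪ A l with hA'
  have hA'T : ∀ l, A' l ⊆ T := fun l =>
    Finset.union_subset Finset.inter_subset_left ((hAS l).trans hST)
  have hTA' : ∀ l, T \ A' l = S \ A l := fun l => by
    ext i; simp only [hA', hSdef, Finset.mem_sdiff, Finset.mem_union, Finset.mem_inter]; tauto
  have hTu : T.card ≤ u := by omega
  have herr : ∀ l, ‖f₀ - ∑ i ∈ A' l, x i • D i‖ ^ 2 ≤ 2 * e + 2 * b * q l := fun l => by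
    have := norm_sq_sub_sum_le (f₀ := f₀) hD (hA'T l) hTu x
    rwa [hTA' l] at this
  have hcardA : ∀ l k₁, k ≤ k₁ → ((A' l \ chosen j k₁).card : ℝ) ≤ 2 ^ l := fun l k₁ hk₁ => by
    have h1 : A' l \ chosen j k₁ ⊆ A l := by
      intro i hi
      simp only [hA', Finset.mem_sdiff, Finset.mem_union, Finset.mem_inter] at hi
      exact hi.1.resolve_left fun h => hi.2 (chosen_mono j hk₁ h.2)
    have h2 : (A' l \ chosen j k₁).card ≤ 2 ^ l := by
      exact (Finset.card_le_card h1).trans ((hAcard l).trans (Nat.sub_le _ _))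
    exact_mod_cast h2
  have hunion : ∀ l k₁, k₁ ≤ k' → (A' l ∪ chosen j k₁).card ≤ u := fun l k₁ hk₁ =>
    calc (A' l ∪ chosen j k₁).card ≤ (A' l).card + (chosen j k₁).card := Finset.card_union_le _ _
      _ ≤ T.card + k₁ := add_le_add (Finset.card_le_card (hA'T l)) (card_chosen_le j k₁)
      _ ≤ u := by omega
  have hstage : ∀ l k₁, k ≤ k₁ → k₁ + κ * 2 ^ l ≤ k' →
      ‖wompResidual D j f₀ (k₁ + κ * 2 ^ l)‖ ^ 2 ≤
        2 * e + 2 * b * q l + a / (32 * b) * ‖wompResidual D j f₀ k₁‖ ^ 2 := by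
    intro l k₁ hk₁ hk₁'
    refine wompResidual_energy_le ht hj hD1 hD ha x (hunion l _ hk₁') (hcardA l k₁ hk₁)
      (by positivity) (herr l) (by positivity) ?_
    have h1 : 1 ≤ κ * (a ^ 2 * t ^ 2) / (32 * b) := (one_le_div (by positivity)).2 hκ
    have h2 := mul_le_mul_of_nonneg_left h1 (by positivity : (0 : ℝ) ≤ 2 ^ l)
    calc (2 : ℝ) ^ l = 2 ^ l * 1 := (mul_one _).symm
      _ ≤ 2 ^ l * (κ * (a ^ 2 * t ^ 2) / (32 * b)) := h2
      _ = ((κ * 2 ^ l : ℕ) : ℝ) * (a * t ^ 2) * (a / (32 * b)) := by push_cast; ring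
  have hρ : a / (32 * b) ≤ 1 / 32 := by
    rw [div_le_iff₀ (by positivity)]; linarith
  have hρ0 : 0 ≤ a / (32 * b) := by positivity
  have hρq : ∀ y, a / (32 * b) * (4 * b * y) = a * y / 8 := fun y => by
    field_simp; ring
  -- At the start of the phase no iteration is needed: `A' 0` consists of selected indices.
  have hstart : ‖wompResidual D j f₀ k‖ ^ 2 ≤ 2 * e + 2 * b * q 0 := by
    refine le_trans (pow_le_pow_left₀ (norm_nonneg _) (norm_wompResidual_le_of_mem ?_) 2) (herr 0)
    rw [selectedSpan_eq_span_chosen]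
    refine Submodule.sum_mem _ fun i hi => Submodule.smul_mem _ _ (Submodule.subset_span ?_)
    have hA0 : A 0 = ∅ := Finset.card_eq_zero.1 (by simpa using hAcard 0)
    simp only [hA', hA0, Finset.union_empty, Finset.mem_inter] at hi
    exact ⟨i, hi.2, rfl⟩
  have hstages : ∀ l ≤ L, ∀ k₁, k₁ + 2 * κ = k + 2 * κ * 2 ^ l →
      ‖wompResidual D j f₀ k₁‖ ^ 2 ≤ 4 * e + 4 * b * q l := by
    intro l
    induction l with
    | zero =>
      intro _ k₁ hk₁
      obtain rfl : k₁ = k := by omega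
      nlinarith [hq0 0]
    | succ l ih =>
      intro hl k₁ hk₁
      have hp : 2 * κ * 1 ≤ 2 * κ * 2 ^ l := Nat.mul_le_mul_left _ Nat.one_le_two_pow
      obtain ⟨k₂, rfl⟩ : ∃ k₂, k₁ = k₂ + κ * 2 ^ (l + 1) :=
        ⟨k₁ - κ * 2 ^ (l + 1), by rw [pow_succ] at hk₁ ⊢; ring_nf at hk₁ hp ⊢; omega⟩
      have hk₂ : k₂ + 2 * κ = k + 2 * κ * 2 ^ l := by rw [pow_succ] at hk₁; linarith
      have hpL : κ * 2 ^ (l + 1) ≤ κ * 2 ^ L :=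
        Nat.mul_le_mul_left _ (Nat.pow_le_pow_right (by norm_num) hl)
      have h1 := hstage (l + 1) k₂ (by omega) (by linarith)
      have h2 := mul_le_mul_of_nonneg_left (ih (by omega) k₂ hk₂) hρ0
      rw [mul_add, hρq] at h2
      have h3 := hLmin l (by omega)
      have h4 := mul_le_mul_of_nonneg_right hρ (by positivity : 0 ≤ 4 * e)
      linarith
  obtain ⟨k₂, rfl⟩ : ∃ k₂, k' = k₂ + κ * 2 ^ (L + 1) := by
    have hp : 2 * κ * 1 ≤ 2 * κ * 2 ^ L := Nat.mul_le_mul_left _ Nat.one_le_two_pow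
    exact ⟨k' - κ * 2 ^ (L + 1), by rw [pow_succ]; ring_nf at hk' hp ⊢; omega⟩
  have hk₂ : k₂ + 2 * κ = k + 2 * κ * 2 ^ L := by rw [pow_succ] at hk'; linarith
  have hkk₂ : k ≤ k₂ := by
    have hp : 2 * κ * 1 ≤ 2 * κ * 2 ^ L := Nat.mul_le_mul_left _ Nat.one_le_two_pow
    omega
  have hfin : ‖wompResidual D j f₀ (k₂ + κ * 2 ^ (L + 1))‖ ^ 2 ≤ 4 * e + a / 4 * q L := by
    have h1 := hstage (L + 1) k₂ hkk₂ le_rfl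
    have h2 := mul_le_mul_of_nonneg_left (hstages L le_rfl k₂ hk₂) hρ0
    rw [mul_add, hρq] at h2
    have h4 := mul_le_mul_of_nonneg_right hρ (by positivity : 0 ≤ 4 * e)
    linarith
  set k' := k₂ + κ * 2 ^ (L + 1) with hk'def
  have hkk' : k ≤ k' := hkk₂.trans (Nat.le_add_right _ _)
  set S' := T \ chosen j k' with hS'
  have hS'S : S' ⊆ S := Finset.sdiff_subset_sdiff subset_rfl (chosen_mono j hkk')
  rcases le_or_gt (q L) (∑ i ∈ S', ‖x i‖ ^ 2) with hcase | hcase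
  · left
    have h1 : a * ∑ i ∈ S', ‖x i‖ ^ 2 ≤ ‖∑ i ∈ T, x i • D i - wompApprox D j f₀ k'‖ ^ 2 :=
      sum_sdiff_chosen_le hD ha.le x ((Finset.card_union_le _ _).trans
        ((Nat.add_le_add_left (card_chosen_le j k') _).trans hu))
    have h2 : ∑ i ∈ T, x i • D i - wompApprox D j f₀ k' =
        wompResidual D j f₀ k' - (f₀ - ∑ i ∈ T, x i • D i) := by
      rw [wompResidual]; abel
    have h3 := pow_le_pow_left₀ (norm_nonneg _)
      (norm_sub_le (wompResidual D j f₀ k') (f₀ - ∑ i ∈ T, x i • D i)) 2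
    rw [← h2] at h3
    have h4 := mul_le_mul_of_nonneg_left hcase ha.le
    nlinarith [sq_nonneg (‖wompResidual D j f₀ k'‖ - ‖f₀ - ∑ i ∈ T, x i • D i‖)]
  · right
    by_contra hlt
    have hsplit : (S \ S').card = S.card - S'.card := Finset.card_sdiff_of_subset hS'S
    have h1 := hAmin L (S \ S') Finset.sdiff_subset (by omega)
    rw [Finset.sdiff_sdiff_eq_self hS'S] at h1
    exact absurd hcase (not_lt.2 h1)

/-- With `s` indices of `T` left to select, `4 κ s` further iterations suffice. -/
lemma norm_sq_wompResidual_le_of_card [Finite ι] {t : ℝ} (ht : 0 < t) (hj : IsWOMP D t f₀ j)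
    (hD1 : ∀ i, ‖D i‖ ≤ 1) {a b : ℝ} {u : ℕ} (hD : IsSparseRiesz D a b u) (ha : 0 < a)
    (hab : a ≤ b) {κ : ℕ} (hκ : 32 * b ≤ κ * (a ^ 2 * t ^ 2)) (T : Finset ι) (x : ι → ℂ)
    (s k : ℕ) (hs : (T \ chosen j k).card ≤ s) (hu : T.card + (k + 4 * κ * s) ≤ u) :
    ‖wompResidual D j f₀ (k + 4 * κ * s)‖ ^ 2 ≤ 9 * ‖f₀ - ∑ i ∈ T, x i • D i‖ ^ 2 := by
  have hanti : ∀ {k l : ℕ}, k ≤ l →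
      ‖wompResidual D j f₀ l‖ ^ 2 ≤ ‖wompResidual D j f₀ k‖ ^ 2 := fun h =>
    pow_le_pow_left₀ (norm_nonneg _) (norm_wompResidual_antitone h) 2
  induction s using Nat.strong_induction_on generalizing k with
  | _ s ih =>
  rcases (T \ chosen j k).eq_empty_or_nonempty with hS | hS
  · refine (hanti (Nat.le_add_right _ _)).trans ?_
    have h1 : ‖wompResidual D j f₀ k‖ ≤ ‖f₀ - ∑ i ∈ T, x i • D i‖ := by
      refine norm_wompResidual_le_of_mem ?_
      rw [selectedSpan_eq_span_chosen]
      exact Submodule.sum_mem _ fun i hi => Submodule.smul_mem _ _ (Submodule.subset_span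
        ⟨i, Finset.sdiff_eq_empty_iff_subset.1 hS hi, rfl⟩)
    have h2 := pow_le_pow_left₀ (norm_nonneg _) h1 2
    linarith [sq_nonneg ‖f₀ - ∑ i ∈ T, x i • D i‖]
  · obtain ⟨L, hL, hphase⟩ := exists_wompResidual_phase ht hj hD1 hD ha hab hκ T x k hS
    have hp : 4 * κ * 1 ≤ 4 * κ * 2 ^ L := Nat.mul_le_mul_left _ Nat.one_le_two_pow
    have hLs : 4 * κ * 2 ^ L ≤ 4 * κ * s := Nat.mul_le_mul_left _ (hL.trans hs)
    obtain ⟨k', hk'⟩ : ∃ k', k' + 2 * κ = k + 4 * κ * 2 ^ L :=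
      ⟨k + 4 * κ * 2 ^ L - 2 * κ, by omega⟩
    rcases hphase k' hk' (by omega) with h | h
    · exact (hanti (by omega)).trans h
    · obtain ⟨s', rfl⟩ : ∃ s', s = 2 ^ L + s' := ⟨s - 2 ^ L, by have := hL.trans hs; omega⟩
      have hpos : 0 < 2 ^ L := Nat.two_pow_pos L
      have heq : k + 4 * κ * (2 ^ L + s') = k + 4 * κ * 2 ^ L + 4 * κ * s' := by ring
      rw [heq] at hu ⊢
      refine ih s' (by omega) _ ?_ hu
      have h1 := Finset.card_le_card (Finset.sdiff_subset_sdiff (subset_refl T)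
        (chosen_mono j (by omega : k' ≤ k + 4 * κ * 2 ^ L)))
      omega

/-- The Lebesgue-type inequality for the Weak Orthogonal Matching Pursuit with respect to a
dictionary with the restricted isometry property: the constants `a`, `b` and `t` enter the number
`4 κ v` of iterations only. -/
theorem norm_wompResidual_le_of_mem_sparseSet [Finite ι] {t : ℝ} (ht : 0 < t)
    (hj : IsWOMP D t f₀ j) (hD1 : ∀ i, ‖D i‖ ≤ 1) {a b : ℝ} {u : ℕ}
    (hD : IsSparseRiesz D a b u) (ha : 0 < a) (hab : a ≤ b) {κ : ℕ}
    (hκ : 32 * b ≤ κ * (a ^ 2 * t ^ 2)) {v : ℕ} (hu : v + 4 * κ * v ≤ u) {g : H}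
    (hg : g ∈ sparseSet D v) :
    ‖wompResidual D j f₀ (4 * κ * v)‖ ≤ 3 * ‖f₀ - g‖ := by
  obtain ⟨T, rfl, hg⟩ := hg
  obtain ⟨x, rfl⟩ := mem_span_image_finset.1 hg
  have h := norm_sq_wompResidual_le_of_card ht hj hD1 hD ha hab hκ T x T.card 0
    (Finset.card_le_card Finset.sdiff_subset) (by omega)
  rw [zero_add] at h
  refine le_of_sq_le_sq (h.trans_eq ?_) (by positivity)
  ring

end Phases

/-! ### Sparse sets and restriction to the points -/

lemma mem_sparseSet_of_mem_span {N : ℕ} {E : Type*} [AddCommGroup E] [Module ℂ E]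
    {D : Fin N → E} {u : ℕ} (hu : u ≤ N) {J : Finset (Fin N)} (hJ : J.card ≤ u) {f : E}
    (hf : f ∈ Submodule.span ℂ (D '' (J : Set (Fin N)))) : f ∈ sparseSet D u := by
  obtain ⟨J', hJJ', hJ'⟩ := Finset.exists_superset_card_eq hJ (by simpa using hu)
  exact ⟨J', hJ', Submodule.span_mono (Set.image_mono (Finset.coe_subset.2 hJJ')) hf⟩

lemma sum_smul_mem_span_image {ι E : Type*} [AddCommGroup E] [Module ℂ E] (D : ι → E)
    (J : Finset ι) (z : ι → ℂ) :
    ∑ i ∈ J, z i • D i ∈ Submodule.span ℂ (D '' (J : Set ι)) :=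
  mem_span_image_finset.2 ⟨z, rfl⟩

/-- The restriction `restrictTo ξ` as a linear map. -/
noncomputable def restrictLinear {Ω : Type*} {m : ℕ} (ξ : Fin m → Ω) :
    (Ω → ℂ) →ₗ[ℂ] DiscreteL2 m where
  toFun := restrictTo ξ
  map_add' _ _ := rfl
  map_smul' _ _ := rfl

section Restriction

variable {Ω : Type*} {m : ℕ} (ξ : Fin m → Ω)

@[simp] lemma restrictLinear_apply (f : Ω → ℂ) : restrictLinear ξ f = restrictTo ξ f := rfl

lemma restrictTo_sub (f g : Ω → ℂ) : restrictTo ξ (f - g) = restrictTo ξ f - restrictTo ξ g :=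
  (restrictLinear ξ).map_sub f g

lemma restrictTo_sum_smul {ι : Type*} (J : Finset ι) (z : ι → ℂ) (φ : ι → Ω → ℂ) :
    restrictTo ξ (∑ i ∈ J, z i • φ i) = ∑ i ∈ J, z i • restrictTo ξ (φ i) := by
  rw [← restrictLinear_apply, map_sum]
  rfl

lemma norm_restrictTo_sq (f : Ω → ℂ) :
    ‖restrictTo ξ f‖ ^ 2 = 1 / (m : ℝ) * ∑ ν, ‖f (ξ ν)‖ ^ 2 := by
  have hs : AEStronglyMeasurable (fun ν => f (ξ ν)) (uniformMeasure m) :=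
    (MemLp.of_discrete (p := 2)).1
  have h : ‖restrictTo ξ f‖ = √(1 / (m : ℝ) * ∑ ν, ‖f (ξ ν)‖ ^ 2) := by
    rw [restrictTo, Lp.norm_toLp, toReal_eLpNorm hs,
      lpNorm_eq_integral_norm_rpow_toReal (by norm_num) (by norm_num) hs, uniformMeasure,
      integral_smul_measure, integral_count, Real.sqrt_eq_rpow]
    simp
  rw [h, Real.sq_sqrt (by positivity)]

lemma norm_restrictTo_le {f : Ω → ℂ} {S : ℝ} (hS : 0 ≤ S) (hf : ∀ x, ‖f x‖ ≤ S) :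
    ‖restrictTo ξ f‖ ≤ S := by
  refine le_of_sq_le_sq ?_ hS
  rw [norm_restrictTo_sq]
  have h1 : ∑ ν, ‖f (ξ ν)‖ ^ 2 ≤ m * S ^ 2 := by
    refine (Finset.sum_le_card_nsmul Finset.univ _ (S ^ 2) fun ν _ =>
      pow_le_pow_left₀ (norm_nonneg _) (hf _) 2).trans_eq ?_
    simp
  calc 1 / (m : ℝ) * ∑ ν, ‖f (ξ ν)‖ ^ 2 ≤ 1 / (m : ℝ) * (m * S ^ 2) :=
        mul_le_mul_of_nonneg_left h1 (by positivity)
    _ = (m : ℝ)⁻¹ * m * S ^ 2 := by ring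
    _ ≤ S ^ 2 := mul_le_of_le_one_left (sq_nonneg S) inv_mul_le_one

lemma exists_mem_selectedSpan_restrictTo_eq {N : ℕ} (φ : Fin N → Ω → ℂ) (j : ℕ → Fin N)
    (k : ℕ) {y : DiscreteL2 m} (hy : y ∈ selectedSpan (fun i => restrictTo ξ (φ i)) j k) :
    ∃ g ∈ selectedSpan φ j k, restrictTo ξ g = y := by
  rw [selectedSpan_eq_span_chosen, mem_span_image_finset] at hy
  obtain ⟨z, rfl⟩ := hy
  refine ⟨∑ i ∈ chosen j k, z i • φ i, ?_, restrictTo_sum_smul ξ _ z φ⟩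
  rw [selectedSpan_eq_span_chosen]
  exact sum_smul_mem_span_image _ _ _

end Restriction

lemma lpNorm_le_of_forall_norm_le {Ω : Type*} [MeasurableSpace Ω] {μ : Measure Ω}
    [IsProbabilityMeasure μ] {f : Ω → ℂ} {S : ℝ} (hf : ∀ x, ‖f x‖ ≤ S) : lpNorm f 2 μ ≤ S := by
  obtain ⟨x⟩ : Nonempty Ω := nonempty_of_isProbabilityMeasure μ
  have hS : 0 ≤ S := (norm_nonneg _).trans (hf x)
  refine (lpNorm_mono_real (memLp_const S) hf).trans_eq ?_
  rw [lpNorm_const (by norm_num) (IsProbabilityMeasure.ne_zero μ)]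
  simp [abs_of_nonneg hS]

/-! ### Consequences of universal discretization -/

section Discretization

variable {Ω : Type*} [MeasurableSpace Ω] {μ : Measure Ω} {N m : ℕ} {φ : Fin N → Ω → ℂ}
  {ξ : Fin m → Ω} {u : ℕ} {R₁ R₂ : ℝ}

lemma UniversalDiscretization.bounds (hU : UniversalDiscretization μ ξ φ u) {f : Ω → ℂ}
    (hf : f ∈ sparseSet φ u) :
    1 / 2 * lpNorm f 2 μ ^ 2 ≤ ‖restrictTo ξ f‖ ^ 2 ∧
      ‖restrictTo ξ f‖ ^ 2 ≤ 3 / 2 * lpNorm f 2 μ ^ 2 := by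
  rw [norm_restrictTo_sq]
  exact hU f hf

lemma IsUniformlyBoundedRieszBasis.lpNorm_sum_sq_bounds
    (hφ : IsUniformlyBoundedRieszBasis μ φ R₁ R₂) (hR₁ : 0 ≤ R₁) (J : Finset (Fin N))
    (z : Fin N → ℂ) :
    R₁ ^ 2 * ∑ i ∈ J, ‖z i‖ ^ 2 ≤ lpNorm (∑ i ∈ J, z i • φ i) 2 μ ^ 2 ∧
      lpNorm (∑ i ∈ J, z i • φ i) 2 μ ^ 2 ≤ R₂ ^ 2 * ∑ i ∈ J, ‖z i‖ ^ 2 := by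
  set w : Fin N → ℂ := fun i => if i ∈ J then z i else 0 with hw
  have h1 : ∑ i, w i • φ i = ∑ i ∈ J, z i • φ i := by simp [hw, ite_smul]
  have h2 : ∑ i, ‖w i‖ ^ 2 = ∑ i ∈ J, ‖z i‖ ^ 2 := by simp [hw, apply_ite, ite_pow]
  have hs : 0 ≤ ∑ i ∈ J, ‖z i‖ ^ 2 := Finset.sum_nonneg fun _ _ => by positivity
  have hl := hφ.lower w
  have hu := hφ.upper w
  rw [h1, h2] at hl hu
  have hl' := pow_le_pow_left₀ (by positivity) hl 2
  have hu' := pow_le_pow_left₀ lpNorm_nonneg hu 2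
  rw [mul_pow, Real.sq_sqrt hs] at hl' hu'
  exact ⟨hl', hu'⟩

lemma IsUniformlyBoundedRieszBasis.isSparseRiesz_restrictTo
    (hφ : IsUniformlyBoundedRieszBasis μ φ R₁ R₂) (hR₁ : 0 ≤ R₁) (hu : u ≤ N)
    (hU : UniversalDiscretization μ ξ φ u) :
    IsSparseRiesz (fun i => restrictTo ξ (φ i)) (R₁ ^ 2 / 2) (3 * R₂ ^ 2 / 2) u where
  lower J hJ z := by
    have h1 := (hU.bounds (mem_sparseSet_of_mem_span hu hJ (sum_smul_mem_span_image φ J z))).1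
    have h2 := (hφ.lpNorm_sum_sq_bounds hR₁ J z).1
    rw [restrictTo_sum_smul] at h1
    linarith
  upper J hJ z := by
    have h1 := (hU.bounds (mem_sparseSet_of_mem_span hu hJ (sum_smul_mem_span_image φ J z))).2
    have h2 := (hφ.lpNorm_sum_sq_bounds hR₁ J z).2
    rw [restrictTo_sum_smul] at h1
    linarith

lemma IsUniformlyBoundedRieszBasis.memLp (hφ : IsUniformlyBoundedRieszBasis μ φ R₁ R₂)
    [IsFiniteMeasure μ] {s : Set (Fin N)} {g : Ω → ℂ} (hg : g ∈ Submodule.span ℂ (φ '' s)) :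
    MemLp g 2 μ := by
  induction hg using Submodule.span_induction with
  | mem x hx =>
    obtain ⟨i, _, rfl⟩ := hx
    exact MemLp.of_bound (hφ.aestronglyMeasurable i) 1 (ae_of_all _ (hφ.norm_le_one i))
  | zero => exact MemLp.zero
  | add x y _ _ hx hy => exact hx.add hy
  | smul c x _ hx => exact hx.const_smul c

lemma IsUniformlyBoundedRieszBasis.bounded (hφ : IsUniformlyBoundedRieszBasis μ φ R₁ R₂)
    {s : Set (Fin N)} {g : Ω → ℂ} (hg : g ∈ Submodule.span ℂ (φ '' s)) :
    ∃ B : ℝ, ∀ x, ‖g x‖ ≤ B := by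
  induction hg using Submodule.span_induction with
  | mem x hx =>
    obtain ⟨i, _, rfl⟩ := hx
    exact ⟨1, hφ.norm_le_one i⟩
  | zero => exact ⟨0, by simp⟩
  | add x y _ _ hx hy =>
    obtain ⟨B, hB⟩ := hx
    obtain ⟨B', hB'⟩ := hy
    exact ⟨B + B', fun p => (norm_add_le _ _).trans (add_le_add (hB p) (hB' p))⟩
  | smul c x _ hx =>
    obtain ⟨B, hB⟩ := hx
    exact ⟨‖c‖ * B, fun p => by
      rw [Pi.smul_apply, norm_smul]
      exact mul_le_mul_of_nonneg_left (hB p) (norm_nonneg _)⟩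

/-- Sparse functions are determined, at every point of `Ω`, by their values at the points `ξ ν`. -/
lemma IsUniformlyBoundedRieszBasis.eq_zero_of_restrictTo_eq_zero
    (hφ : IsUniformlyBoundedRieszBasis μ φ R₁ R₂) (hR₁ : 0 < R₁) (hu : u ≤ N)
    (hU : UniversalDiscretization μ ξ φ u) {g : Ω → ℂ} (hg : g ∈ sparseSet φ u)
    (h0 : restrictTo ξ g = 0) : g = 0 := by
  obtain ⟨J, hJ, hgJ⟩ := hg
  obtain ⟨z, rfl⟩ := mem_span_image_finset.1 hgJ
  have h1 := (hφ.isSparseRiesz_restrictTo hR₁.le hu hU).lower J hJ.le z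
  rw [← restrictTo_sum_smul, h0, norm_zero, zero_pow two_ne_zero] at h1
  have h2 : ∑ i ∈ J, ‖z i‖ ^ 2 ≤ 0 := nonpos_of_mul_nonpos_right h1 (by positivity)
  have h3 := (Finset.sum_eq_zero_iff_of_nonneg (fun i _ => by positivity)).1
    (le_antisymm h2 (Finset.sum_nonneg fun _ _ => by positivity))
  refine Finset.sum_eq_zero fun i hi => ?_
  rw [norm_eq_zero.1 (pow_eq_zero_iff two_ne_zero |>.1 (h3 i hi)), zero_smul]

lemma lpNorm_le_mul_norm_restrictTo (hU : UniversalDiscretization μ ξ φ u) {g : Ω → ℂ}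
    (hg : g ∈ sparseSet φ u) : lpNorm g 2 μ ≤ 3 / 2 * ‖restrictTo ξ g‖ := by
  refine le_of_sq_le_sq ?_ (by positivity)
  nlinarith [(hU.bounds hg).1, sq_nonneg ‖restrictTo ξ g‖]

end Discretization

lemma le_mul_bestApprox {N : ℕ} {E : Type*} [AddCommGroup E] [Module ℂ E] {nrm : E → ℝ}
    {D : Fin N → E} {v : ℕ} (hv : v ≤ N) {f : E} {C y : ℝ} (hC : 0 ≤ C)
    (h : ∀ g ∈ sparseSet D v, y ≤ C * nrm (f - g)) : y ≤ C * bestApprox nrm D v f := by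
  have : Nonempty (sparseSet D v) :=
    ⟨⟨0, mem_sparseSet_of_mem_span hv (J := ∅) (by simp) (zero_mem _)⟩⟩
  rw [bestApprox, Real.mul_iInf_of_nonneg hC]
  exact le_ciInf fun g => h g g.2

end SparseRecovery

/-! ### Recovery from samples -/

open SparseRecovery

theorem theorem1p2 :
    ∃ C : ℝ, 1 < C ∧
      ∀ t R₁ R₂ : ℝ, 0 < t → t ≤ 1 → 0 < R₁ → R₁ ≤ R₂ →
        ∃ c : ℕ, 1 ≤ c ∧
          ∀ (Ω : Type*) [MeasurableSpace Ω] (μ : MeasureTheory.Measure Ω)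
            [MeasureTheory.IsProbabilityMeasure μ]
            (N : ℕ) (φ : Fin N → Ω → ℂ),
            SparseRecovery.IsUniformlyBoundedRieszBasis μ φ R₁ R₂ →
            ∀ u : ℕ, 1 ≤ u → u ≤ N →
            ∀ (m : ℕ) (ξ : Fin m → Ω), SparseRecovery.UniversalDiscretization μ ξ φ u →
            ∀ v : ℕ, (v : ℝ) ≤ (u : ℝ) / (1 + (c : ℝ)) →
            ∀ f₀ : Ω → ℂ, MeasureTheory.AEStronglyMeasurable f₀ μ →
            (∃ B : ℝ, ∀ x, ‖f₀ x‖ ≤ B) →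
            ∀ j : ℕ → Fin N,
            SparseRecovery.IsWOMP (fun i => SparseRecovery.restrictTo ξ (φ i)) t
              (SparseRecovery.restrictTo ξ f₀) j →
              ‖SparseRecovery.wompResidual (fun i => SparseRecovery.restrictTo ξ (φ i)) j
                  (SparseRecovery.restrictTo ξ f₀) (c * v)‖ ≤
                C * SparseRecovery.bestApprox norm
                  (fun i => SparseRecovery.restrictTo ξ (φ i)) v
                  (SparseRecovery.restrictTo ξ f₀) ∧
              ∃ r : Ω → ℂ,
                SparseRecovery.IsResidualFunction ξ φ j f₀ (c * v) r ∧
                (∀ r', SparseRecovery.IsResidualFunction ξ φ j f₀ (c * v) r' → r' = r) ∧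
                MeasureTheory.lpNorm r 2 μ ≤
                  C * SparseRecovery.bestApprox SparseRecovery.supNorm φ v f₀ := by
  -- `7 = 1 + (3 / 2) * (1 + 3)`, where `3 / 2` bounds the `√2` from the discretization.
  refine ⟨7, by norm_num, fun t R₁ R₂ ht _ hR₁ hR₁₂ => ?_⟩
  have hR₂ : 0 < R₂ := hR₁.trans_le hR₁₂
  -- `κ` makes `κ 2 ^ l` iterations shrink the excess energy by the factor `a / (32 b)`.
  set a : ℝ := R₁ ^ 2 / 2 with ha_def
  set b : ℝ := 3 * R₂ ^ 2 / 2 with hb_def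
  have ha : 0 < a := by positivity
  have hb : 0 < b := by positivity
  have hab : a ≤ b := by
    have := pow_le_pow_left₀ hR₁.le hR₁₂ 2
    rw [ha_def, hb_def]; nlinarith
  obtain ⟨κ, hκ0⟩ := exists_nat_ge (32 * b / (a ^ 2 * t ^ 2))
  have hκ : 32 * b ≤ κ * (a ^ 2 * t ^ 2) := (div_le_iff₀ (by positivity)).1 hκ0
  have hκ1 : 1 ≤ κ := by
    rcases Nat.eq_zero_or_pos κ with rfl | h
    · rw [Nat.cast_zero, zero_mul] at hκ; linarith
    · exact h
  refine ⟨4 * κ, by omega, ?_⟩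
  intro Ω _ μ _ N φ hφ u _ huN m ξ hU v hv f₀ hf₀ hf₀b j hj
  have hvu : v + 4 * κ * v ≤ u := by
    rw [le_div_iff₀ (by positivity)] at hv
    have : v * (1 + 4 * κ) ≤ u := by exact_mod_cast hv
    linarith
  have hvN : v ≤ N := by omega
  have hD := hφ.isSparseRiesz_restrictTo hR₁.le huN hU
  have hD1 : ∀ i, ‖restrictTo ξ (φ i)‖ ≤ 1 := fun i =>
    norm_restrictTo_le ξ zero_le_one (hφ.norm_le_one i)
  have hmain : ∀ g ∈ sparseSet (fun i => restrictTo ξ (φ i)) v, _ := fun g hg =>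
    norm_wompResidual_le_of_mem_sparseSet (f₀ := restrictTo ξ f₀) ht hj hD1 hD ha hab hκ hvu hg
  refine ⟨le_mul_bestApprox hvN (by norm_num) fun g hg => (hmain g hg).trans
    (mul_le_mul_of_nonneg_right (by norm_num) (norm_nonneg _)), ?_⟩
  obtain ⟨g, hg, hgr⟩ := exists_mem_selectedSpan_restrictTo_eq ξ φ j (4 * κ * v)
    (wompApprox_mem (f₀ := restrictTo ξ f₀) (4 * κ * v))
  have hcard : (chosen j (4 * κ * v)).card ≤ 4 * κ * v := card_chosen_le j _
  refine ⟨f₀ - g, ⟨g, hg, hgr, rfl⟩, ?_, ?_⟩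
  · rintro _ ⟨g', hg', hgr', rfl⟩
    have h0 : g' - g = 0 := by
      refine hφ.eq_zero_of_restrictTo_eq_zero hR₁ huN hU
        (mem_sparseSet_of_mem_span huN (J := chosen j (4 * κ * v)) (by omega) ?_) ?_
      · rw [← selectedSpan_eq_span_chosen]
        exact Submodule.sub_mem _ hg' hg
      · rw [restrictTo_sub, hgr, hgr', sub_self]
    rw [sub_eq_zero.1 h0]
  · refine le_mul_bestApprox hvN (by norm_num) ?_
    rintro h ⟨J, hJ, hhJ⟩
    have hsup : ∀ x, ‖(f₀ - h) x‖ ≤ supNorm (f₀ - h) := by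
      obtain ⟨B, hB⟩ := hf₀b
      obtain ⟨B', hB'⟩ := hφ.bounded hhJ
      refine le_ciSup (f := fun x => ‖(f₀ - h) x‖) ⟨B + B', ?_⟩
      rintro _ ⟨x, rfl⟩
      exact (norm_sub_le _ _).trans (add_le_add (hB x) (hB' x))
    have hsup0 : 0 ≤ supNorm (f₀ - h) := Real.iSup_nonneg fun _ => norm_nonneg _
    have hg' : g ∈ Submodule.span ℂ (φ '' (chosen j (4 * κ * v) : Set (Fin N))) := by
      rwa [← selectedSpan_eq_span_chosen]
    have hsparse : h - g ∈ sparseSet φ u := by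
      refine mem_sparseSet_of_mem_span huN (J := J ∪ chosen j (4 * κ * v))
        ((Finset.card_union_le _ _).trans (by omega)) ?_
      rw [Finset.coe_union, Set.image_union]
      exact Submodule.sub_mem _ (Submodule.span_mono Set.subset_union_left hhJ)
        (Submodule.span_mono Set.subset_union_right hg')
    have hres := hmain (restrictTo ξ h) (by
      obtain ⟨z, rfl⟩ := mem_span_image_finset.1 hhJ
      exact ⟨J, hJ, by rw [restrictTo_sum_smul]; exact sum_smul_mem_span_image _ _ _⟩)
    rw [wompResidual, ← hgr, ← restrictTo_sub, ← restrictTo_sub] at hres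
    have hdisc := norm_restrictTo_le ξ hsup0 hsup
    have hdiff : ‖restrictTo ξ (h - g)‖ ≤ 4 * supNorm (f₀ - h) := by
      have : h - g = (f₀ - g) - (f₀ - h) := by abel
      rw [this, restrictTo_sub]
      refine (norm_sub_le _ _).trans ?_
      linarith
    have hmem : MemLp (f₀ - h) 2 μ :=
      MemLp.of_bound (hf₀.sub (hφ.memLp hhJ).1) _ (ae_of_all _ hsup)
    have htri := lpNorm_add_le (g := h - g) hmem (by norm_num)
    rw [sub_add_sub_cancel] at htri
    linarith [lpNorm_le_mul_norm_restrictTo hU hsparse,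
      lpNorm_le_of_forall_norm_le (μ := μ) hsup]
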